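/- All graphs are finite and simple. An acyclic moral orientation (AMO) of an undirected graph $H$ is an orientation of all edges of $H$ that has no directed cycle and no induced subgraph $a\to b\leftarrow c$ (that is, no such edges with $a\ne c$ non-adjacent in $H$); let $\#\mathrm{AMO}(H)$ be the number of AMOs of $H$. A topological ordering representing an orientation $\alpha$ is a linear ordering of all vertices in which $u$ precedes $v$ for every edge $u\to v$ of $\alpha$. Let $G=(V,E)$ be a connected chordal graph (no induced cycle on four or more vertices), and let $\Pi(G)$ be the set of its inclusion-maximal cliques. For a clique $K$ and a permutation $\pi$ of $K$, let $G^{\pi(K)}$ be the union of all AMOs of $G$ that are represented by some topological ordering beginning with $\pi$, and let $G^K=\bigcup_\pi G^{\pi(K)}$, where $\pi$ ranges over all permutations of $K$; an edge that occurs in both directions in such a union is called undirected. Let $\mathcal C_G(K)$ be the set of undirected connected components of $G^K[V\setminus K]$, i.e. the connected components of the undirected graph on $V\setminus K$ formed by the undirected edges of $G^K$ between vertices of $V\setminus K$. For a finite set $S$ and a collection $R$ of subsets of $S$, let $\phi(S,R)$ be the number of permutations of $S$ that have no initial segment whose set of elements belongs to $R$. A rooted clique tree of $G$ is a triple $\mathcal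 T=(T,r,\iota)$ in which $T=(V_T,E_T)$ is a tree with root $r$ and $\iota\colon V_T\to\Pi(G)$ is a bijection such that for every $u\in V$ the set $\{x\in V_T\mid u\in\iota(x)\}$ is connected in $T$. For a node $v$, let $r=x_1,x_2,\dots,x_p=v$ be the unique path in $T$ from $r$ to $v$, and let $$\mathrm{FP}(v,\mathcal T)=\{\,\iota(x_i)\cap\iota(x_{i+1})\mid 1\le i<p,\ \iota(x_i)\cap\iota(x_{i+1})\subseteq\iota(v)\,\}.$$ Proposition. For every connected chordal graph $G$ and every rooted clique tree $\mathcal T=(T,r,\iota)$ of $G$, $$\#\mathrm{AMO}(G)=\sum_{v\in V_T}\phi\bigl(\iota(v),\mathrm{FP}(v,\mathcal T)\bigr)\cdot\prod_{H\in\mathcal C_G(\iota(v))}\#\mathrm{AMO}(H).$$ -/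

import Mathlib

namespace CliquePicking

/-- A graph is chordal if it has no induced cycle on four or more vertices. -/
def IsChordal {V : Type*} (G : SimpleGraph V) : Prop :=
  ∀ n : ℕ, 4 ≤ n → IsEmpty (SimpleGraph.cycleGraph n ↪g G)

/-- Undirected connected chordal graphs. -/
structure IsUCCG {V : Type*} (G : SimpleGraph V) : Prop where
  connected : G.Connected
  chordal : IsChordal G

/-- `D` is an acyclic moral orientation of the undirected graph `G`. -/
structure IsAMO {V : Type*} (G : SimpleGraph V) (D : Digraph V) : Prop where
  /-- the skeleton of `D` is `G` -/
  skeleton : ∀ u v, G.Adj u v ↔ D.Adj u v ∨ D.Adj v u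
  /-- every edge has received only one direction -/
  oriented : ∀ u v, D.Adj u v → ¬ D.Adj v u
  /-- there is no directed cycle -/
  acyclic : ∀ v, ¬ Relation.TransGen D.Adj v v
  /-- there is no induced `a → b ← c` -/
  moral : ∀ a b c, a ≠ c → D.Adj a b → D.Adj c b → G.Adj a c

/-- The number of acyclic moral orientations of `G`. -/
noncomputable def numAMO {V : Type*} (G : SimpleGraph V) : ℕ :=
  {D : Digraph V | IsAMO G D}.ncard

section

variable {V : Type*} [DecidableEq V]

/-- `τ` lists every vertex exactly once, and every edge of `D` points from an earlier vertex of `τ`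
to a later one. -/
structure IsTopologicalOrdering (D : Digraph V) (τ : List V) : Prop where
  nodup : τ.Nodup
  complete : ∀ v, v ∈ τ
  precedes : ∀ u v, D.Adj u v → τ.idxOf u < τ.idxOf v

/-- The permutations of a finite set `S`, as duplicate-free lists with underlying set `S`. -/
def permsOf (S : Finset V) : Set (List V) :=
  {π | π.Nodup ∧ π.toFinset = S}

/-- `φ(S, R)`: the number of permutations of `S` no initial segment of which has a member of `R` as
its underlying set. -/
noncomputable def phi (S : Finset V) (R : Set (Finset V)) : ℕ :=
  {π ∈ permsOf S | ∀ p : List V, p <+: π → p.toFinset ∉ R}.ncard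

/-- The union `G^π` of all AMOs of `G` that are represented by some topological ordering beginning
with the sequence `π`. -/
def permOrientation (G : SimpleGraph V) (π : List V) : Digraph V :=
  sSup {D | IsAMO G D ∧ ∃ τ, IsTopologicalOrdering D τ ∧ π <+: τ}

/-- The union `G^K` of the graphs `G^π` over all permutations `π` of `K`. -/
def cliqueOrientation (G : SimpleGraph V) (K : Finset V) : Digraph V :=
  ⨆ π ∈ permsOf K, permOrientation G π

/-- The undirected edges of `G^K[V ∖ K]`. -/
def undirectedPart (G : SimpleGraph V) (K : Finset V) : SimpleGraph {v : V // v ∉ K} :=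
  (cliqueOrientation G K).toSimpleGraphStrict.comap Subtype.val

/-- `C_G(K)`: the undirected connected components of `G^K[V ∖ K]`. The graph belonging to a
component `H` is `H.toSimpleGraph`. -/
abbrev Components (G : SimpleGraph V) (K : Finset V) : Type _ :=
  (undirectedPart G K).ConnectedComponent

noncomputable instance instFintypeComponents [Fintype V] (G : SimpleGraph V) (K : Finset V) :
    Fintype (Components G K) :=
  Fintype.ofFinite _

end

/-- The set `Π(G)` of (inclusion-)maximal cliques. -/
def maximalCliques {V : Type*} (G : SimpleGraph V) : Set (Finset V) :=
  {K | Maximal (fun K' : Finset V => G.IsClique (K' : Set V)) K}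

/-- A rooted clique tree `(T, r, ι)` of `G` with node set `W`. -/
structure RootedCliqueTree {V : Type*} (G : SimpleGraph V) (W : Type*) where
  T : SimpleGraph W
  r : W
  ι : W → Finset V
  isTree : T.IsTree
  /-- `ι` is a bijection from the nodes onto the maximal cliques of `G` -/
  bijOn : Set.BijOn ι Set.univ (maximalCliques G)
  /-- the nodes whose clique contains a given vertex form a connected subgraph of `T` -/
  connected : ∀ v : V, (T.induce {x | v ∈ ι x}).Connected

/-- The forbidden prefixes of a node `v`: the sets `ι x ∩ ι y ⊆ ι v` for the successive nodes
`x, y` on the path from the root to `v`. -/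
def RootedCliqueTree.FP {V W : Type*} [DecidableEq V] {G : SimpleGraph V}
    (𝒯 : RootedCliqueTree G W) (v : W) : Set (Finset V) :=
  {S | ∃ p : 𝒯.T.Walk 𝒯.r v, p.IsPath ∧
    ∃ d ∈ p.darts, S = 𝒯.ι d.fst ∩ 𝒯.ι d.snd ∧ S ⊆ 𝒯.ι v}

end CliquePicking

/-!
Call a set of vertices ancestral for an acyclic moral orientation if no edge enters it. Every such
orientation has exactly one node of the clique tree whose bag is ancestral while none of its
forbidden prefixes is. For the existence, delete the tree edges whose separator is ancestral: some
bag in the component of the root is ancestral, because inside the union of these bags an ancestral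
clique can be enlarged until it is maximal, and no edge enters the union from outside. For the
uniqueness, two ancestral bags have an ancestral intersection, and this intersection is the
separator of some edge on the tree path between them.

The orientation arranges its ancestral bag `K` in a permutation `π`, and the ancestral subsets of
`K` are the initial segments of `π`, so `π` is one of the permutations counted by `φ`. Once `π` is
fixed, an edge outside of `K` either is forced by moralness and acyclicity, or is free. All ends of
a component of free edges receive the same forced edges, so the free edges can be reoriented by any
AMO of the graph that they form. Doing so creates no directed triangle, hence no directed cycle, as
the graph has a perfect numbering. The free edges are therefore exactly the undirected edges of
`G^K`, and their orientations are chosen independently on the components.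
-/

namespace CliquePicking

open Relation

section Orientations

variable {V : Type*} {G : SimpleGraph V} {D : Digraph V}

/-- A set of vertices is ancestral for a directed graph if no edge enters it. For an acyclic
digraph these are the sets that can be listed first by a topological ordering. -/
def Ancestral (D : Digraph V) (S : Set V) : Prop :=
  ∀ ⦃u v⦄, D.Adj u v → v ∈ S → u ∈ S

theorem Ancestral.inter {S T : Set V} (hS : Ancestral D S) (hT : Ancestral D T) :
    Ancestral D (S ∩ T) :=
  fun _ _ huv hv => ⟨hS huv hv.1, hT huv hv.2⟩

theorem IsAMO.adj (hD : IsAMO G D) {u v : V} (h : D.Adj u v) : G.Adj u v :=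
  (hD.skeleton u v).2 (Or.inl h)

theorem IsAMO.adj_of_not_adj (hD : IsAMO G D) {u v : V} (huv : G.Adj u v) (h : ¬ D.Adj v u) :
    D.Adj u v :=
  ((hD.skeleton u v).1 huv).resolve_right h

theorem Ancestral.adj_of_notMem {S : Set V} (hS : Ancestral D S) (hD : IsAMO G D) {u v : V}
    (huv : G.Adj u v) (hu : u ∈ S) (hv : v ∉ S) : D.Adj u v :=
  hD.adj_of_not_adj huv fun h => hv (hS h hu)

theorem IsAMO.wellFounded_transGen [Finite V] (hD : IsAMO G D) :
    WellFounded (TransGen D.Adj) :=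
  have : Std.Irrefl (TransGen D.Adj) := ⟨hD.acyclic⟩
  Finite.wellFounded_of_trans_of_irrefl _

end Orientations

section InitialPerms

variable {V : Type*} [DecidableEq V] {G : SimpleGraph V} {D : Digraph V} {K : Finset V}
  {π τ : List V}

theorem finite_permsOf (K : Finset V) : (permsOf K).Finite := by
  refine Set.Finite.subset (K.val.lists.finite_toSet) fun π hπ => ?_
  obtain ⟨hnodup, rfl⟩ := hπ
  simp [hnodup.dedup]

theorem isTopologicalOrdering_iff_pairwise (hirrefl : ∀ v, ¬ D.Adj v v) :
    IsTopologicalOrdering D τ ↔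
      τ.Nodup ∧ (∀ v, v ∈ τ) ∧ τ.Pairwise fun u v => ¬ D.Adj v u := by
  constructor
  · intro hτ
    refine ⟨hτ.nodup, hτ.complete, List.pairwise_iff_getElem.2 fun i j hi hj hij h => ?_⟩
    have := hτ.precedes _ _ h
    rw [hτ.nodup.idxOf_getElem, hτ.nodup.idxOf_getElem] at this
    exact lt_asymm hij this
  · rintro ⟨hnodup, hcomplete, hpairwise⟩
    refine ⟨hnodup, hcomplete, fun u v huv => ?_⟩
    have hne : τ.idxOf u ≠ τ.idxOf v := fun h =>
      hirrefl v ((List.idxOf_inj (hcomplete u)).1 h ▸ huv)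
    refine hne.lt_or_gt.resolve_right fun hlt => ?_
    have := List.pairwise_iff_getElem.1 hpairwise _ _
      (List.idxOf_lt_length_of_mem (hcomplete v)) (List.idxOf_lt_length_of_mem (hcomplete u)) hlt
    rw [List.getElem_idxOf, List.getElem_idxOf] at this
    exact this huv

theorem exists_mem_permsOf_pairwise_not_adj (hD : ∀ v, ¬ TransGen D.Adj v v) (S : Finset V) :
    ∃ l ∈ permsOf S, l.Pairwise fun u v => ¬ D.Adj v u := by
  classical
  have : IsPartialOrder V (ReflTransGen D.Adj) :=
    { refl := fun _ => .refl
      trans := fun _ _ _ => .trans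
      antisymm := fun a b hab hba => by
        by_contra hne
        exact hD a (((reflTransGen_iff_eq_or_transGen.1 hab).resolve_left (Ne.symm hne)).trans_left
          hba) }
  obtain ⟨s, _, hle⟩ := extend_partialOrder (ReflTransGen D.Adj)
  refine ⟨S.sort s, ⟨S.sort_nodup s, S.sort_toFinset s⟩, ?_⟩
  refine ((S.pairwise_sort s).and (S.sort_nodup s)).imp ?_
  rintro u v ⟨huv, hne⟩ h
  exact hne (antisymm huv (hle _ _ (.single h)))

theorem IsAMO.pairwise_adj (hD : IsAMO G D) (hK : G.IsClique (K : Set V)) (hπ : π ∈ permsOf K)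
    (h : π.Pairwise fun u v => ¬ D.Adj v u) : π.Pairwise D.Adj := by
  obtain ⟨hnodup, rfl⟩ := hπ
  refine (h.and hnodup).imp_of_mem ?_
  rintro u v hu hv ⟨hvu, hne⟩
  exact hD.adj_of_not_adj (hK (by simpa using hu) (by simpa using hv) hne) hvu

/-- The orientation `D` starts with the set `K`, whose elements it orders as in the list `π`. For
an AMO of a graph in which `K` is a clique, this says that `D` is represented by a topological
ordering that begins with `π`. -/
structure IsInitialPerm (D : Digraph V) (K : Finset V) (π : List V) : Prop where
  mem_permsOf : π ∈ permsOf K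
  ancestral : Ancestral D (K : Set V)
  pairwise : π.Pairwise D.Adj

theorem IsTopologicalOrdering.isInitialPerm (hτ : IsTopologicalOrdering D τ) (hD : IsAMO G D)
    (hK : G.IsClique (K : Set V)) (hπ : π ∈ permsOf K) (hπτ : π <+: τ) :
    IsInitialPerm D K π := by
  obtain ⟨l, rfl⟩ := hπτ
  obtain ⟨-, hcomplete, hpairwise⟩ :=
    (isTopologicalOrdering_iff_pairwise fun v h => hD.oriented v v h h).1 hτ
  obtain ⟨hπpairwise, -, hcross⟩ := List.pairwise_append.1 hpairwise
  refine ⟨hπ, fun u v huv hv => ?_, hD.pairwise_adj hK hπ hπpairwise⟩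
  rw [← hπ.2, List.coe_toFinset, Set.mem_ofPred_eq] at hv ⊢
  exact (List.mem_append.1 (hcomplete u)).resolve_right fun hu => hcross v hv u hu huv

theorem IsInitialPerm.exists_isTopologicalOrdering [Finite V] (h : IsInitialPerm D K π)
    (hD : IsAMO G D) : ∃ τ, IsTopologicalOrdering D τ ∧ π <+: τ := by
  cases nonempty_fintype V
  obtain ⟨l, ⟨hl, hlS⟩, hlpairwise⟩ :=
    exists_mem_permsOf_pairwise_not_adj hD.acyclic (Finset.univ \ K)
  have hmem_π (v : V) : v ∈ π ↔ v ∈ K := by rw [← h.mem_permsOf.2, List.mem_toFinset]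
  have hmem_l (v : V) : v ∈ l ↔ v ∉ K := by
    rw [← List.mem_toFinset, hlS, Finset.mem_sdiff, and_iff_right (Finset.mem_univ v)]
  refine ⟨π ++ l, (isTopologicalOrdering_iff_pairwise fun v h => hD.oriented v v h h).2
    ⟨h.mem_permsOf.1.append hl fun v hv hvl => (hmem_l v).1 hvl ((hmem_π v).1 hv),
      fun v => ?_, List.pairwise_append.2 ⟨h.pairwise.imp (hD.oriented _ _), hlpairwise, ?_⟩⟩,
    List.prefix_append _ _⟩
  · rw [List.mem_append, hmem_π, hmem_l]
    exact em _
  · intro u hu v hv hvu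
    exact (hmem_l v).1 hv (h.ancestral hvu ((hmem_π u).1 hu))

theorem existsUnique_isInitialPerm (hD : IsAMO G D) (hK : G.IsClique (K : Set V))
    (hanc : Ancestral D (K : Set V)) : ∃! π, IsInitialPerm D K π := by
  obtain ⟨π, hπ, hpairwise⟩ := exists_mem_permsOf_pairwise_not_adj hD.acyclic K
  refine ⟨π, ⟨hπ, hanc, hD.pairwise_adj hK hπ hpairwise⟩, fun π' h' => ?_⟩
  refine List.Perm.eq_of_pairwise (fun u v _ _ huv hvu => (hD.oriented u v huv hvu).elim)
    h'.pairwise (hD.pairwise_adj hK hπ hpairwise) ?_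
  exact List.perm_of_nodup_nodup_toFinset_eq h'.mem_permsOf.1 hπ.1
    (h'.mem_permsOf.2.trans hπ.2.symm)

theorem IsInitialPerm.exists_prefix_iff (h : IsInitialPerm D K π)
    (horiented : ∀ u v, D.Adj u v → ¬ D.Adj v u) {S : Finset V} (hS : S ⊆ K) :
    (∃ p, p <+: π ∧ p.toFinset = S) ↔ Ancestral D (S : Set V) := by
  have hmem (v : V) : v ∈ K ↔ v ∈ π := by rw [← h.mem_permsOf.2, List.mem_toFinset]
  constructor
  · rintro ⟨p, ⟨q, rfl⟩, rfl⟩ u v huv hv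
    have hu := (hmem u).1 (h.ancestral huv (hS hv))
    rw [List.coe_toFinset, Set.mem_ofPred_eq] at hv ⊢
    exact (List.mem_append.1 hu).resolve_right fun hq =>
      horiented u v huv ((List.pairwise_append.1 h.pairwise).2.2 v hv u hq)
  · intro hanc
    refine ⟨π.takeWhile (· ∈ S), List.takeWhile_prefix _, Finset.Subset.antisymm ?_ ?_⟩
    · intro v hv
      simpa using List.mem_takeWhile_imp (List.mem_toFinset.1 hv)
    · intro v hv
      have hvπ := (hmem v).1 (hS hv)
      have hpairwise := h.pairwise
      rw [← List.takeWhile_append_dropWhile (p := (· ∈ S)) (l := π), List.mem_append] at hvπ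
      rw [← List.takeWhile_append_dropWhile (p := (· ∈ S)) (l := π)] at hpairwise
      refine List.mem_toFinset.2 (hvπ.resolve_right fun hdrop => ?_)
      have hne := List.ne_nil_of_mem hdrop
      have hhead : (π.dropWhile (· ∈ S)).head hne ∉ S := by
        simpa using List.head_dropWhile_not (· ∈ S) hne
      obtain ⟨x, t, hxt⟩ := List.exists_cons_of_ne_nil hne
      simp only [hxt, List.head_cons, List.mem_cons] at hhead hdrop hpairwise
      rcases hdrop with rfl | hvt
      · exact hhead hv
      · obtain ⟨-, hpairwise_tail, -⟩ := List.pairwise_append.1 hpairwise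
        exact hhead (hanc ((List.pairwise_cons.1 hpairwise_tail).1 v hvt) hv)

end InitialPerms

section Trees

variable {W : Type*} {T : SimpleGraph W} {C : Set W}

theorem exists_walk_of_induce_preconnected (hC : (T.induce C).Preconnected) {x y : W}
    (hx : x ∈ C) (hy : y ∈ C) : ∃ p : T.Walk x y, ∀ z ∈ p.support, z ∈ C := by
  obtain ⟨p⟩ := hC ⟨x, hx⟩ ⟨y, hy⟩
  refine ⟨p.map (SimpleGraph.Embedding.induce C).toHom, fun z hz => ?_⟩
  obtain ⟨a, -, rfl⟩ := List.mem_map.1 (SimpleGraph.Walk.support_map _ p ▸ hz)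
  exact a.2

theorem exists_gate (hT : T.IsTree) (hC : (T.induce C).Connected) (z : W) :
    ∃ g ∈ C, ∀ c ∈ C, ∀ p : T.Walk z c, g ∈ p.support := by
  classical
  obtain ⟨⟨c₀, hc₀⟩⟩ := hC.nonempty
  obtain ⟨q⟩ := hT.connected.preconnected z c₀
  induction q with
  | nil => exact ⟨_, hc₀, fun _ _ p => p.start_mem_support⟩
  | @cons z z' _ h _ ih =>
    obtain ⟨g, hg, hgate⟩ := ih hc₀
    by_cases hz : z ∈ C
    · exact ⟨z, hz, fun _ _ p => p.start_mem_support⟩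
    by_cases hz' : z' ∈ C
    · refine ⟨z', hz', fun c hc p => p.support_bypass_subset_support ?_⟩
      obtain ⟨s, hs⟩ := exists_walk_of_induce_preconnected hC.preconnected hz' hc
      have hpath : (SimpleGraph.Walk.cons h s.bypass).IsPath :=
        (SimpleGraph.Walk.cons_isPath_iff _ _).2 ⟨s.bypass_isPath,
          fun hmem => hz (hs z (s.support_bypass_subset_support hmem))⟩
      rw [(hT.existsUnique_path z c).unique p.bypass_isPath hpath]
      simp
    · refine ⟨g, hg, fun c hc p => ?_⟩
      exact (List.mem_cons.1 (hgate c hc (p.cons h.symm))).resolve_left fun h => hz' (h ▸ hg)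

end Trees

namespace RootedCliqueTree

variable {V W : Type*} {G : SimpleGraph V} (𝒯 : RootedCliqueTree G W)

theorem maximal (x : W) : Maximal (fun K : Finset V => G.IsClique (K : Set V)) (𝒯.ι x) :=
  𝒯.bijOn.mapsTo (Set.mem_univ x)

theorem isClique (x : W) : G.IsClique (𝒯.ι x : Set V) :=
  (𝒯.maximal x).prop

theorem eq_of_subset {x y : W} (h : 𝒯.ι x ⊆ 𝒯.ι y) : x = y :=
  𝒯.bijOn.injOn (Set.mem_univ x) (Set.mem_univ y)
    ((𝒯.maximal x).eq_of_ge (𝒯.isClique y) h).symm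

theorem exists_subset_of_isClique [Finite V] {Q : Finset V} (hQ : G.IsClique (Q : Set V)) :
    ∃ z, Q ⊆ 𝒯.ι z := by
  obtain ⟨K, hle, hK⟩ := Finite.exists_le_maximal
    (p := fun K : Finset V => G.IsClique (K : Set V)) hQ
  obtain ⟨z, -, rfl⟩ := 𝒯.bijOn.surjOn hK
  exact ⟨z, hle⟩

theorem exists_mem_of_adj [Finite V] {u v : V} (h : G.Adj u v) :
    ∃ z, u ∈ 𝒯.ι z ∧ v ∈ 𝒯.ι z := by
  classical
  obtain ⟨z, hz⟩ := 𝒯.exists_subset_of_isClique (Q := {u, v}) (by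
    simp [SimpleGraph.isClique_insert, h])
  exact ⟨z, hz (by simp), hz (by simp)⟩

theorem exists_walk_of_mem {u : V} {x y : W} (hx : u ∈ 𝒯.ι x) (hy : u ∈ 𝒯.ι y) :
    ∃ p : 𝒯.T.Walk x y, ∀ z ∈ p.support, u ∈ 𝒯.ι z :=
  exists_walk_of_induce_preconnected (𝒯.connected u).preconnected hx hy

theorem path_eq {x y : W} {p q : 𝒯.T.Walk x y} (hp : p.IsPath) (hq : q.IsPath) : p = q :=
  (𝒯.isTree.existsUnique_path x y).unique hp hq

theorem mem_of_mem_support_path {u : V} {x y z : W} {p : 𝒯.T.Walk x y} (hp : p.IsPath)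
    (hx : u ∈ 𝒯.ι x) (hy : u ∈ 𝒯.ι y) (hz : z ∈ p.support) : u ∈ 𝒯.ι z := by
  classical
  obtain ⟨q, hq⟩ := 𝒯.exists_walk_of_mem hx hy
  rw [𝒯.path_eq hp q.bypass_isPath] at hz
  exact hq z (q.support_bypass_subset_support hz)

theorem diff_subset_of_walk {S X : Set V} (hX : ∀ d ∈ X, ∀ n, n ∉ S → G.Adj n d → n ∈ X)
    {x y : W} (p : 𝒯.T.Walk x y)
    (hp : ∀ d ∈ p.darts, ¬ (𝒯.ι d.fst ∩ 𝒯.ι d.snd : Set V) ⊆ S)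
    (hx : (𝒯.ι x : Set V) \ S ⊆ X) : (𝒯.ι y : Set V) \ S ⊆ X := by
  induction p with
  | nil => exact hx
  | @cons x z y hxz p ih =>
    simp only [SimpleGraph.Walk.darts_cons, List.mem_cons, forall_eq_or_imp] at hp
    refine ih hp.2 fun k hk => ?_
    obtain ⟨m, hm, hmS⟩ := Set.not_subset.1 hp.1
    have hmX := hx ⟨hm.1, hmS⟩
    by_cases hkm : k = m
    · exact hkm ▸ hmX
    · exact hX m hmX k hk.2 (𝒯.isClique z hk.1 hm.2 hkm)

end RootedCliqueTree

section AncestralCliques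

variable {V : Type*} {G : SimpleGraph V} {D : Digraph V}

theorem IsAMO.mem_insert_of_adj [DecidableEq V] (hD : IsAMO G D) {X : Set V} {Q : Finset V}
    {m : V} (hQ : ∀ u v, D.Adj u v → v ∈ Q → u ∈ X → u ∈ Q) (hmX : m ∈ X) (hmQ : m ∉ Q)
    (hm : ∀ q ∈ Q, G.Adj m q)
    (hmin : ∀ u ∈ X, u ∉ Q → (∀ q ∈ Q, G.Adj u q) → ¬ D.Adj u m) :
    ∀ u v, D.Adj u v → v ∈ insert m Q → u ∈ X → u ∈ insert m Q := by
  intro u v huv hv huX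
  refine Finset.mem_insert_of_mem ?_
  rcases Finset.mem_insert.1 hv with rfl | hv
  · by_contra huQ
    refine hmin u huX huQ (fun q hq => ?_) huv
    have hqv : D.Adj q v := hD.adj_of_not_adj (hm q hq).symm fun h => hmQ (hQ _ _ h hq hmX)
    exact hD.moral u v q (fun h => huQ (h ▸ hq)) huv hqv
  · exact hQ u v huv hv huX

theorem IsAMO.exists_maximal_isClique_ancestral [Finite V] (hD : IsAMO G D) (X : Set V) :
    ∃ Q : Finset V, Maximal (fun Q : Finset V => G.IsClique (Q : Set V) ∧ (Q : Set V) ⊆ X) Q ∧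
      ∀ u v, D.Adj u v → v ∈ Q → u ∈ X → u ∈ Q := by
  classical
  obtain ⟨Q, -, hQ⟩ := Finite.exists_le_maximal
    (p := fun Q : Finset V => (G.IsClique (Q : Set V) ∧ (Q : Set V) ⊆ X) ∧
      ∀ u v, D.Adj u v → v ∈ Q → u ∈ X → u ∈ Q) (a := ∅) (by simp)
  obtain ⟨⟨hclique, hsub⟩, hanc⟩ := hQ.prop
  refine ⟨Q, ⟨⟨hclique, hsub⟩, fun Q' ⟨hclique', hsub'⟩ hle v hv => ?_⟩, hanc⟩
  by_contra hvQ
  obtain ⟨m, ⟨hmX, hmQ, hm⟩, hmin⟩ := hD.wellFounded_transGen.has_min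
    {m | m ∈ X ∧ m ∉ Q ∧ ∀ q ∈ Q, G.Adj m q}
    ⟨v, hsub' hv, hvQ, fun q hq => hclique' hv (hle hq) fun h => hvQ (h ▸ hq)⟩
  refine hmQ (hQ.le_of_ge (y := insert m Q) ⟨⟨?_, ?_⟩, ?_⟩ (Finset.subset_insert _ _)
    (Finset.mem_insert_self _ _))
  · rw [Finset.coe_insert, SimpleGraph.isClique_insert]
    exact ⟨hclique, fun q hq _ => hm q hq⟩
  · rw [Finset.coe_insert, Set.insert_subset_iff]
    exact ⟨hmX, hsub⟩
  · exact hD.mem_insert_of_adj hanc hmX hmQ hm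
      fun u huX huQ hu h => hmin u ⟨huX, huQ, hu⟩ (.single h)

/-- The vertices reachable in `D` from `A \ S` along directed walks that avoid `S`. For two
ancestral sets `A` and `B` with `A ∩ B ⊆ S`, this set separates `A` from `B` outside of `S`. -/
def descendantsAvoiding (D : Digraph V) (A S : Set V) : Set V :=
  {d | ∃ a ∈ A \ S, ReflTransGen (fun u v => D.Adj u v ∧ v ∉ S) a d}

theorem diff_subset_descendantsAvoiding (D : Digraph V) (A S : Set V) :
    A \ S ⊆ descendantsAvoiding D A S :=
  fun a ha => ⟨a, ha, .refl⟩

theorem IsAMO.mem_descendantsAvoiding_of_adj (hD : IsAMO G D) {A S : Set V} (hA : Ancestral D A)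
    {d n : V} (hd : d ∈ descendantsAvoiding D A S) (hn : n ∉ S) (hnd : G.Adj n d) :
    n ∈ descendantsAvoiding D A S := by
  obtain ⟨a, ha, had⟩ := hd
  induction had generalizing n with
  | refl =>
    rcases (hD.skeleton _ _).1 hnd with h | h
    · exact ⟨n, ⟨hA h ha.1, hn⟩, .refl⟩
    · exact ⟨a, ha, .single ⟨h, hn⟩⟩
  | @tail c d hac hcd ih =>
    rcases (hD.skeleton _ _).1 hnd with h | h
    · by_cases hne : n = c
      · exact ⟨a, ha, hne ▸ hac⟩
      · exact ih hn (hD.moral n d c hne h hcd.1)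
    · exact ⟨a, ha, (hac.tail hcd).tail ⟨h, hn⟩⟩

theorem Ancestral.disjoint_descendantsAvoiding {A B S : Set V} (hB : Ancestral D B)
    (hAB : A ∩ B ⊆ S) : Disjoint (descendantsAvoiding D A S) B := by
  refine Set.disjoint_left.2 ?_
  rintro d ⟨a, ha, had⟩
  induction had with
  | refl => exact fun haB => ha.2 (hAB ⟨ha.1, haB⟩)
  | tail _ h ih => exact fun hd => ih (hB h.1 hd)

end AncestralCliques

namespace RootedCliqueTree

variable {V W : Type*} [DecidableEq V] {G : SimpleGraph V} (𝒯 : RootedCliqueTree G W)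
  {D : Digraph V}

theorem exists_dart_inter_eq (hD : IsAMO G D) {x y : W} (hx : Ancestral D (𝒯.ι x : Set V))
    (hy : Ancestral D (𝒯.ι y : Set V)) (hne : x ≠ y) {p : 𝒯.T.Walk x y} (hp : p.IsPath) :
    ∃ d ∈ p.darts, 𝒯.ι d.fst ∩ 𝒯.ι d.snd = 𝒯.ι x ∩ 𝒯.ι y := by
  obtain ⟨d, hd, hsub⟩ : ∃ d ∈ p.darts,
      (𝒯.ι d.fst ∩ 𝒯.ι d.snd : Set V) ⊆ 𝒯.ι x ∩ 𝒯.ι y := by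
    by_contra! hcon
    have hsub := 𝒯.diff_subset_of_walk
      (fun _ hd _ hn hnd => hD.mem_descendantsAvoiding_of_adj hx hd hn hnd) p hcon
      (diff_subset_descendantsAvoiding D _ _)
    obtain ⟨k, hky, hkx⟩ := Finset.not_subset.1 fun h => hne (𝒯.eq_of_subset h).symm
    exact Set.disjoint_left.1 (hy.disjoint_descendantsAvoiding subset_rfl)
      (hsub ⟨hky, fun hk => hkx hk.1⟩) hky
  refine ⟨d, hd, Finset.Subset.antisymm (mod_cast hsub) fun k hk => ?_⟩
  rw [Finset.mem_inter] at hk ⊢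
  exact ⟨𝒯.mem_of_mem_support_path hp hk.1 hk.2 (p.dart_fst_mem_support_of_mem_darts hd),
    𝒯.mem_of_mem_support_path hp hk.1 hk.2 (p.dart_snd_mem_support_of_mem_darts hd)⟩

/-- The forest obtained from the clique tree by deleting the edges whose separator is ancestral
for `D`. -/
def nonancestralForest (D : Digraph V) : SimpleGraph W where
  Adj x y := 𝒯.T.Adj x y ∧ ¬ Ancestral D (𝒯.ι x ∩ 𝒯.ι y : Finset V)
  symm := ⟨fun x y h => ⟨h.1.symm, by rw [Finset.inter_comm]; exact h.2⟩⟩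
  loopless := ⟨fun x h => 𝒯.T.loopless.irrefl x h.1⟩

theorem nonancestralForest_le : 𝒯.nonancestralForest D ≤ 𝒯.T :=
  fun _ _ h => h.1

/-- The component of the root in `nonancestralForest`. -/
def rootComponent (D : Digraph V) : Set W :=
  ((𝒯.nonancestralForest D).connectedComponentMk 𝒯.r).supp

theorem connected_induce_rootComponent : (𝒯.T.induce (𝒯.rootComponent D)).Connected :=
  ((𝒯.nonancestralForest D).connectedComponentMk 𝒯.r).connected_toSimpleGraph.mono
    fun _ _ h => 𝒯.nonancestralForest_le h

theorem exists_path_of_mem_rootComponent {w : W} (hw : w ∈ 𝒯.rootComponent D) :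
    ∃ p : 𝒯.T.Walk 𝒯.r w, p.IsPath ∧
      ∀ d ∈ p.darts, ¬ Ancestral D (𝒯.ι d.fst ∩ 𝒯.ι d.snd : Finset V) := by
  classical
  obtain ⟨q⟩ := (SimpleGraph.ConnectedComponent.exact hw).symm
  refine ⟨q.bypass.mapLe 𝒯.nonancestralForest_le, q.bypass_isPath.mapLe _, fun d hd => ?_⟩
  have hd' : d.edge ∈ q.bypass.edges := by
    rw [← SimpleGraph.Walk.edges_mapLe_eq_edges 𝒯.nonancestralForest_le]
    exact List.mem_map_of_mem hd
  exact (q.bypass.adj_of_mem_edges hd').2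

theorem mem_rootComponent_of_adj {x y : W} (hx : x ∈ 𝒯.rootComponent D) (h : 𝒯.T.Adj x y)
    (hxy : ¬ Ancestral D (𝒯.ι x ∩ 𝒯.ι y : Finset V)) : y ∈ 𝒯.rootComponent D :=
  SimpleGraph.ConnectedComponent.mem_supp_of_adj_mem_supp _ hx ⟨h, hxy⟩

theorem exists_mem_rootComponent_of_adj [Finite V] (hD : IsAMO G D) {w : W}
    (hw : w ∈ 𝒯.rootComponent D) {u v : V} (huv : D.Adj u v) (hv : v ∈ 𝒯.ι w) :
    ∃ x ∈ 𝒯.rootComponent D, u ∈ 𝒯.ι x := by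
  obtain ⟨y, huy, hvy⟩ := 𝒯.exists_mem_of_adj (hD.adj huv)
  by_cases hy : y ∈ 𝒯.rootComponent D
  · exact ⟨y, hy, huy⟩
  obtain ⟨p, hp⟩ := 𝒯.exists_walk_of_mem hv hvy
  obtain ⟨d, hd, hfst, hsnd⟩ := p.exists_boundary_dart _ hw hy
  have hv_sep : v ∈ 𝒯.ι d.fst ∩ 𝒯.ι d.snd :=
    Finset.mem_inter.2 ⟨hp _ (p.dart_fst_mem_support_of_mem_darts hd),
      hp _ (p.dart_snd_mem_support_of_mem_darts hd)⟩
  have hsep : Ancestral D (𝒯.ι d.fst ∩ 𝒯.ι d.snd : Finset V) :=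
    not_not.1 fun h => hsnd (𝒯.mem_rootComponent_of_adj hfst d.adj h)
  exact ⟨d.fst, hfst, (Finset.mem_inter.1 (hsep huv hv_sep)).1⟩

theorem exists_ancestral_mem_rootComponent [Finite V] (hD : IsAMO G D) :
    ∃ w ∈ 𝒯.rootComponent D, Ancestral D (𝒯.ι w : Set V) := by
  obtain ⟨Q, hQ, hanc⟩ :=
    hD.exists_maximal_isClique_ancestral {k | ∃ x ∈ 𝒯.rootComponent D, k ∈ 𝒯.ι x}
  obtain ⟨z, hz⟩ := 𝒯.exists_subset_of_isClique hQ.prop.1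
  obtain ⟨w, hw, hgate⟩ := exists_gate 𝒯.isTree 𝒯.connected_induce_rootComponent z
  have hQw : Q ⊆ 𝒯.ι w := fun k hk => by
    obtain ⟨x, hx, hkx⟩ := hQ.prop.2 hk
    obtain ⟨p, hp⟩ := 𝒯.exists_walk_of_mem (hz hk) hkx
    exact hp w (hgate x hx p)
  obtain rfl : 𝒯.ι w = Q := hQ.eq_of_ge ⟨𝒯.isClique w, fun k hk => ⟨w, hw, hk⟩⟩ hQw
  exact ⟨w, hw, fun u v huv hv =>
    hanc u v huv hv (𝒯.exists_mem_rootComponent_of_adj hD hw huv hv)⟩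

theorem exists_ancestral_mem_FP (hD : IsAMO G D) {x y : W} (hx : Ancestral D (𝒯.ι x : Set V))
    (hy : Ancestral D (𝒯.ι y : Set V)) (hne : x ≠ y) {p : 𝒯.T.Walk 𝒯.r x}
    (hp : ∀ d ∈ p.darts, ¬ Ancestral D (𝒯.ι d.fst ∩ 𝒯.ι d.snd : Finset V)) :
    ∃ S ∈ 𝒯.FP y, Ancestral D (S : Set V) := by
  classical
  obtain ⟨q, hq, -⟩ := 𝒯.isTree.existsUnique_path 𝒯.r y
  obtain ⟨d, hd, heq⟩ := 𝒯.exists_dart_inter_eq hD hx hy hne (p.reverse.append q).bypass_isPath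
  have hanc : Ancestral D (𝒯.ι d.fst ∩ 𝒯.ι d.snd : Finset V) := by
    rw [heq, Finset.coe_inter]
    exact hx.inter hy
  have hd := (p.reverse.append q).darts_bypass_subset_darts hd
  rw [SimpleGraph.Walk.darts_append, List.mem_append, SimpleGraph.Walk.mem_darts_reverse] at hd
  rcases hd with hdp | hdq
  · rw [Finset.inter_comm] at hanc
    exact absurd hanc (hp d.symm hdp)
  · exact ⟨_, ⟨q, hq, d, hdq, rfl, heq.subset.trans Finset.inter_subset_right⟩, hanc⟩

theorem existsUnique_ancestral_node [Finite V] (hD : IsAMO G D) :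
    ∃! w, Ancestral D (𝒯.ι w : Set V) ∧ ∀ S ∈ 𝒯.FP w, ¬ Ancestral D (S : Set V) := by
  obtain ⟨w, hw, hanc⟩ := 𝒯.exists_ancestral_mem_rootComponent hD
  obtain ⟨p, hp, hp_darts⟩ := 𝒯.exists_path_of_mem_rootComponent hw
  refine ⟨w, ⟨hanc, ?_⟩, ?_⟩
  · rintro _ ⟨q, hq, d, hd, rfl, -⟩
    exact hp_darts d (𝒯.path_eq hp hq ▸ hd)
  · rintro y ⟨hy, hFP⟩
    by_contra hne
    obtain ⟨S, hS, hS_anc⟩ := 𝒯.exists_ancestral_mem_FP hD hanc hy (Ne.symm hne) hp_darts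
    exact hFP S hS hS_anc

end RootedCliqueTree

section PerfectNumberings

variable {V α : Type*} [LinearOrder α] {G : SimpleGraph V} {f : V → α}

/-- A numbering of the vertices such that the earlier neighbours of every vertex form a clique,
that is, the reverse of a perfect elimination ordering. -/
structure IsPerfectNumbering (G : SimpleGraph V) (f : V → α) : Prop where
  injective : Function.Injective f
  adj : ∀ a b c, a ≠ c → G.Adj a b → G.Adj c b → f a < f b → f c < f b → G.Adj a c

/-- The orientation of a graph along a numbering of its vertices. -/
def numberingOrientation (G : SimpleGraph V) (f : V → α) : Digraph V where
  Adj u v := G.Adj u v ∧ f u < f v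

theorem IsPerfectNumbering.isAMO (hf : IsPerfectNumbering G f) :
    IsAMO G (numberingOrientation G f) where
  skeleton u v := by
    refine ⟨fun h => ?_, fun h => h.elim And.left fun h => h.1.symm⟩
    exact (hf.injective.ne h.ne).lt_or_gt.imp (⟨h, ·⟩) (⟨h.symm, ·⟩)
  oriented u v h h' := lt_asymm h.2 h'.2
  acyclic v h := by
    have hlt : TransGen (· < ·) (f v) (f v) := h.lift f fun _ _ h => h.2
    rw [transGen_eq_self] at hlt
    exact lt_irrefl _ hlt
  moral a b c hne hab hcb := hf.adj a b c hne hab.1 hcb.1 hab.2 hcb.2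

theorem IsPerfectNumbering.exists_source (hf : IsPerfectNumbering G f) {D : Digraph V}
    (hskeleton : ∀ u v, G.Adj u v ↔ D.Adj u v ∨ D.Adj v u)
    (horiented : ∀ u v, D.Adj u v → ¬ D.Adj v u)
    (htriangle : ∀ a b c, D.Adj a b → D.Adj b c → ¬ D.Adj c a) {S : Finset V}
    (hS : S.Nonempty) : ∃ s ∈ S, ∀ u ∈ S, ¬ D.Adj u s := by
  classical
  induction S using Finset.induction_on_max_value f with
  | empty => exact absurd hS Finset.not_nonempty_empty
  | insert m S hmS hmax ih =>
    have hlt {u : V} (hu : u ∈ S) : f u < f m :=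
      (hmax u hu).lt_of_ne (hf.injective.ne fun h => hmS (h ▸ hu))
    have hmm : ¬ D.Adj m m := fun h => horiented m m h h
    rcases S.eq_empty_or_nonempty with rfl | hne
    · exact ⟨m, by simp, by simpa using hmm⟩
    obtain ⟨s, hs, hsource⟩ := ih hne
    by_cases hms : D.Adj m s
    · refine ⟨m, Finset.mem_insert_self m S, fun u hu hum => ?_⟩
      rcases Finset.mem_insert.1 hu with rfl | hu
      · exact hmm hum
      have hus : G.Adj u s := hf.adj u m s (fun h => horiented m s hms (h ▸ hum))
        ((hskeleton _ _).2 (.inl hum)) ((hskeleton _ _).2 (.inr hms)) (hlt hu) (hlt hs)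
      have hsu : D.Adj s u := ((hskeleton u s).1 hus).resolve_left (hsource u hu)
      exact htriangle s u m hsu hum hms
    · refine ⟨s, Finset.mem_insert_of_mem hs, fun u hu => ?_⟩
      rcases Finset.mem_insert.1 hu with rfl | hu
      · exact hms
      · exact hsource u hu

theorem IsPerfectNumbering.acyclic_of_no_triangle [Finite V] (hf : IsPerfectNumbering G f)
    {D : Digraph V} (hskeleton : ∀ u v, G.Adj u v ↔ D.Adj u v ∨ D.Adj v u)
    (horiented : ∀ u v, D.Adj u v → ¬ D.Adj v u)
    (htriangle : ∀ a b c, D.Adj a b → D.Adj b c → ¬ D.Adj c a) (v : V) :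
    ¬ TransGen D.Adj v v := by
  have hwf : WellFounded D.Adj := WellFounded.wellFounded_iff_has_min.2 fun S hS => by
    obtain ⟨s, hs, hsource⟩ := hf.exists_source hskeleton horiented htriangle
      (S.toFinite.toFinset_nonempty.2 hS)
    exact ⟨s, by simpa using hs, fun u hu => hsource u (by simpa using hu)⟩
  exact hwf.transGen.irrefl.irrefl v

end PerfectNumberings

namespace RootedCliqueTree

variable {V W : Type*} {G : SimpleGraph V} (𝒯 : RootedCliqueTree G W)

/-- The node nearest to `x` among the nodes whose bag contains `u`. -/
noncomputable def top (x : W) (u : V) : W :=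
  (exists_gate 𝒯.isTree (𝒯.connected u) x).choose

theorem mem_ι_top (x : W) (u : V) : u ∈ 𝒯.ι (𝒯.top x u) :=
  (exists_gate 𝒯.isTree (𝒯.connected u) x).choose_spec.1

theorem top_mem_support {x z : W} {u : V} (hz : u ∈ 𝒯.ι z) (p : 𝒯.T.Walk x z) :
    𝒯.top x u ∈ p.support :=
  (exists_gate 𝒯.isTree (𝒯.connected u) x).choose_spec.2 z hz p

/-- The distance from the node `x` to the bags containing the vertex `u`. -/
noncomputable def depth (x : W) (u : V) : ℕ :=
  𝒯.T.dist x (𝒯.top x u)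

theorem depth_eq_zero_iff {x : W} {u : V} : 𝒯.depth x u = 0 ↔ u ∈ 𝒯.ι x := by
  rw [depth, 𝒯.isTree.connected.dist_eq_zero_iff]
  refine ⟨fun h => h ▸ 𝒯.mem_ι_top x u, fun h => ?_⟩
  simpa [eq_comm] using 𝒯.top_mem_support h .nil

theorem mem_ι_top_of_depth_le {x z : W} {a b : V} (ha : a ∈ 𝒯.ι z) (hb : b ∈ 𝒯.ι z)
    (hab : 𝒯.depth x a ≤ 𝒯.depth x b) : a ∈ 𝒯.ι (𝒯.top x b) := by
  classical
  obtain ⟨p, -, hp⟩ := 𝒯.isTree.connected.exists_path_of_dist x (𝒯.top x a)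
  obtain ⟨q, hq⟩ := 𝒯.exists_walk_of_mem (𝒯.mem_ι_top x a) ha
  rcases (SimpleGraph.Walk.mem_support_append_iff _ _).1 (𝒯.top_mem_support hb (p.append q))
    with htop | htop
  · suffices 𝒯.top x b = 𝒯.top x a from this ▸ 𝒯.mem_ι_top x a
    by_contra hne
    have hlt := SimpleGraph.Walk.length_takeUntil_lt_length htop hne
    exact absurd hab (not_le.2 ((SimpleGraph.dist_le _).trans_lt (hp ▸ hlt)))
  · exact hq _ htop

theorem isPerfectNumbering_depth [Finite V] (x : W) {α : Type*} [LinearOrder α] {e : V → α}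
    (he : Function.Injective e) :
    IsPerfectNumbering G fun u => toLex (𝒯.depth x u, e u) where
  injective _ _ h := he (Prod.ext_iff.1 (toLex.injective h)).2
  adj a b c hne hab hcb hlt hlt' := by
    obtain ⟨z, haz, hbz⟩ := 𝒯.exists_mem_of_adj hab
    obtain ⟨z', hcz', hbz'⟩ := 𝒯.exists_mem_of_adj hcb
    exact 𝒯.isClique (𝒯.top x b)
      (𝒯.mem_ι_top_of_depth_le haz hbz (Prod.Lex.monotone_fst _ _ hlt.le))
      (𝒯.mem_ι_top_of_depth_le hcz' hbz' (Prod.Lex.monotone_fst _ _ hlt'.le)) hne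

theorem exists_isPerfectNumbering (𝒯 : RootedCliqueTree G W) [Finite V] :
    ∃ f : V → ℕ ×ₗ Fin (Nat.card V), IsPerfectNumbering G f :=
  ⟨_, 𝒯.isPerfectNumbering_depth 𝒯.r (Finite.equivFin V).injective⟩

theorem exists_isInitialPerm [Finite V] [DecidableEq V] (x : W) {π : List V}
    (hπ : π ∈ permsOf (𝒯.ι x)) : ∃ D, IsAMO G D ∧ IsInitialPerm D (𝒯.ι x) π := by
  have he : Function.Injective fun u => toLex (π.idxOf u, Finite.equivFin V u) :=
    fun _ _ h => (Finite.equivFin V).injective (Prod.ext_iff.1 (toLex.injective h)).2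
  have hmem {u : V} (hu : u ∈ π) : u ∈ 𝒯.ι x := hπ.2 ▸ List.mem_toFinset.2 hu
  refine ⟨_, (𝒯.isPerfectNumbering_depth x he).isAMO, hπ, fun u v huv hv => ?_, ?_⟩
  · have hle := Prod.Lex.monotone_fst _ _ huv.2.le
    rw [← Finset.mem_coe.symm, ← 𝒯.depth_eq_zero_iff] at hv ⊢
    exact Nat.le_zero.1 (hv ▸ hle)
  · refine List.pairwise_iff_getElem.2 fun i j hi hj hij => ⟨?_, ?_⟩
    · exact 𝒯.isClique x (hmem (List.getElem_mem hi)) (hmem (List.getElem_mem hj))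
        fun h => hij.ne (hπ.1.getElem_inj_iff.1 h)
    · simp only [𝒯.depth_eq_zero_iff.2 (hmem (List.getElem_mem hi)),
        𝒯.depth_eq_zero_iff.2 (hmem (List.getElem_mem hj)), Prod.Lex.toLex_lt_toLex,
        hπ.1.idxOf_getElem]
      exact .inr ⟨trivial, .inl hij⟩

theorem exists_isAMO_adj (𝒯 : RootedCliqueTree G W) [Finite V] {u v : V}
    (h : G.Adj u v) : ∃ D, IsAMO G D ∧ D.Adj u v := by
  classical
  obtain ⟨x, hu, hv⟩ := 𝒯.exists_mem_of_adj h
  have hπ : u :: ((𝒯.ι x).erase u).toList ∈ permsOf (𝒯.ι x) := by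
    refine ⟨List.nodup_cons.2 ⟨by simp, Finset.nodup_toList _⟩, ?_⟩
    rw [List.toFinset_cons, Finset.toList_toFinset, Finset.insert_erase hu]
  obtain ⟨D, hD, hinit⟩ := 𝒯.exists_isInitialPerm x hπ
  exact ⟨D, hD, (List.pairwise_cons.1 hinit.pairwise).1 v (by simp [hv, h.ne'])⟩

end RootedCliqueTree

section DetachedSubgraphs

variable {V : Type*} {G F : SimpleGraph V} {D E δ : Digraph V}

/-- The digraph with both directions of every edge of `F`. Intersecting an orientation with it, or
subtracting it, isolates the edges that belong to `F` or do not. -/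
def arcs (F : SimpleGraph V) : Digraph V where
  Adj := F.Adj

/-- The subgraph `F` is detached in the orientation `E` if it looks the same from everywhere
outside: an arc that does not belong to `F` and enters one end of an edge of `F` is accompanied by
such an arc into the other end. The edges of `F` can then be reoriented on their own. -/
def IsDetached (F : SimpleGraph V) (E : Digraph V) : Prop :=
  ∀ ⦃a b c⦄, (E \ arcs F).Adj a b → F.Adj b c → (E \ arcs F).Adj a c

theorem IsDetached.adj_of_adj_of_adj (hF : IsDetached F E) (hE : IsAMO G E) {a b c : V}
    (hab : F.Adj a b) (hbc : F.Adj b c) (hac : G.Adj a c) : F.Adj a c := by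
  by_contra hFac
  rcases (hE.skeleton a c).1 hac with h | h
  · exact (hF ⟨h, hFac⟩ hbc.symm).2 hab
  · exact (hF ⟨h, fun h => hFac h.symm⟩ hab).2 hbc.symm

theorem IsDetached.isAMO_inf (hF : IsDetached F E) (hFG : F ≤ G) (hE : IsAMO G E)
    (hD : IsAMO G D) : IsAMO F (D ⊓ arcs F) where
  skeleton u v := by
    refine ⟨fun h => ?_, fun h => h.elim And.right fun h => h.2.symm⟩
    exact ((hD.skeleton u v).1 (hFG h)).imp (⟨·, h⟩) (⟨·, h.symm⟩)
  oriented u v h h' := hD.oriented u v h.1 h'.1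
  acyclic v h := hD.acyclic v (TransGen.mono (fun _ _ h => h.1) _ _ h)
  moral a b c hne hab hcb :=
    hF.adj_of_adj_of_adj hE hab.2 hcb.2.symm (hD.moral a b c hne hab.1 hcb.1)

theorem IsAMO.sdiff_arcs_sup_oriented (hE : IsAMO G E) (hδ : IsAMO F δ) (u v : V)
    (huv : (E \ arcs F ⊔ δ).Adj u v) : ¬ (E \ arcs F ⊔ δ).Adj v u := by
  rintro (hvu | hvu) <;> rcases huv with huv | huv
  · exact hE.oriented u v huv.1 hvu.1
  · exact hvu.2 (hδ.adj huv).symm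
  · exact huv.2 (hδ.adj hvu).symm
  · exact hδ.oriented u v huv hvu

theorem IsDetached.sdiff_arcs_sup_no_triangle (hF : IsDetached F E) (hE : IsAMO G E)
    (hδ : IsAMO F δ) (a b c : V) (hab : (E \ arcs F ⊔ δ).Adj a b)
    (hbc : (E \ arcs F ⊔ δ).Adj b c) : ¬ (E \ arcs F ⊔ δ).Adj c a := by
  intro hca
  -- In a triangle an arc outside of `F` cannot be followed by an arc of `F`.
  have hnext {x y z : V} (hxy : (E \ arcs F).Adj x y) (hyz : (E \ arcs F ⊔ δ).Adj y z)
      (hzx : (E \ arcs F ⊔ δ).Adj z x) : (E \ arcs F).Adj y z :=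
    hyz.resolve_right fun h =>
      hE.sdiff_arcs_sup_oriented hδ z x hzx (.inl (hF hxy (hδ.adj h)))
  by_cases hout : (E \ arcs F).Adj a b
  · have hout' := hnext hout hbc hca
    exact hE.acyclic a (((TransGen.single hout.1).tail hout'.1).tail (hnext hout' hca hab).1)
  · have hbc' := hbc.resolve_left fun h => hout (hnext (hnext h hca hab) hab hbc)
    have hca' := hca.resolve_left fun h => hout (hnext h hab hbc)
    exact hδ.acyclic a (((TransGen.single (hab.resolve_left hout)).tail hbc').tail hca')

theorem IsDetached.isAMO_sdiff_arcs_sup [Finite V] {α : Type*} [LinearOrder α] {f : V → α}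
    (hf : IsPerfectNumbering G f) (hF : IsDetached F E) (hFG : F ≤ G) (hE : IsAMO G E)
    (hδ : IsAMO F δ) : IsAMO G (E \ arcs F ⊔ δ) := by
  have hskeleton (u v : V) :
      G.Adj u v ↔ (E \ arcs F ⊔ δ).Adj u v ∨ (E \ arcs F ⊔ δ).Adj v u := by
    constructor
    · intro h
      by_cases hFuv : F.Adj u v
      · exact ((hδ.skeleton u v).1 hFuv).imp .inr .inr
      · exact ((hE.skeleton u v).1 h).imp (fun h => .inl ⟨h, hFuv⟩)
          fun h => .inl ⟨h, fun h => hFuv h.symm⟩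
    · have hadj {u v : V} (h : (E \ arcs F ⊔ δ).Adj u v) : G.Adj u v :=
        h.elim (fun h => hE.adj h.1) fun h => hFG (hδ.adj h)
      exact fun h => h.elim hadj fun h => (hadj h).symm
  refine ⟨hskeleton, hE.sdiff_arcs_sup_oriented hδ, hf.acyclic_of_no_triangle hskeleton
    (hE.sdiff_arcs_sup_oriented hδ) (hF.sdiff_arcs_sup_no_triangle hE hδ), ?_⟩
  rintro a b c hne (hab | hab) (hcb | hcb)
  · exact hE.moral a b c hne hab.1 hcb.1
  · exact hE.adj (hF hab (hδ.adj hcb).symm).1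
  · exact (hE.adj (hF hcb (hδ.adj hab).symm).1).symm
  · exact hFG (hδ.moral a b c hne hab hcb)

theorem sdiff_arcs_sup_sdiff_arcs (hδ : IsAMO F δ) : (E \ arcs F ⊔ δ) \ arcs F = E \ arcs F := by
  have hle : δ ≤ arcs F := fun _ _ h => hδ.adj h
  rw [sup_sdiff, sdiff_idem, sdiff_eq_bot_iff.2 hle, sup_bot_eq]

theorem IsDetached.ncard_setOf_sdiff_arcs_eq [Finite V] {α : Type*} [LinearOrder α] {f : V → α}
    (hf : IsPerfectNumbering G f) (hF : IsDetached F E) (hFG : F ≤ G) (hE : IsAMO G E) :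
    {D | IsAMO G D ∧ D \ arcs F = E \ arcs F}.ncard = numAMO F := by
  refine Set.BijOn.ncard_eq (f := (· ⊓ arcs F)) (Set.InvOn.bijOn (f' := (E \ arcs F ⊔ ·))
    ⟨fun D hD => ?_, fun δ hδ => ?_⟩ (fun D hD => hF.isAMO_inf hFG hE hD.1)
    fun δ hδ => ⟨hF.isAMO_sdiff_arcs_sup hf hFG hE hδ, sdiff_arcs_sup_sdiff_arcs hδ⟩)
  · change E \ arcs F ⊔ D ⊓ arcs F = D
    rw [← hD.2, sup_comm, sup_inf_sdiff]
  · have hle : δ ≤ arcs F := fun _ _ h => hδ.adj h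
    change (E \ arcs F ⊔ δ) ⊓ arcs F = δ
    rw [inf_sup_right, inf_comm, inf_sdiff_self_right, bot_sup_eq, inf_eq_left.2 hle]

end DetachedSubgraphs

section ForcedEdges

variable {V : Type*} {G : SimpleGraph V} {K : Finset V} {D : Digraph V}

/-- The edges whose orientation is forced as soon as the set `K` is ancestral. -/
inductive Forced (G : SimpleGraph V) (K : Finset V) : V → V → Prop
  | base {k v : V} : k ∈ K → v ∉ K → G.Adj k v → Forced G K k v
  | moral {a b c : V} : Forced G K a b → G.Adj b c → a ≠ c → ¬ G.Adj a c → Forced G K b c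
  | trans {a b c : V} : Forced G K a b → Forced G K b c → G.Adj a c → Forced G K a c

theorem Forced.adj_of_ancestral (hD : IsAMO G D) (hK : Ancestral D (K : Set V)) {a b : V}
    (h : Forced G K a b) : D.Adj a b := by
  induction h with
  | base hk hv hkv => exact hK.adj_of_notMem hD hkv hk hv
  | moral _ hbc hne hac ih => exact hD.adj_of_not_adj hbc fun h => hac (hD.moral _ _ _ hne ih h)
  | trans _ _ hac ih₁ ih₂ =>
    exact hD.adj_of_not_adj hac fun h => hD.acyclic _ (((TransGen.single ih₁).tail ih₂).tail h)

theorem Forced.adj_of_not_forced {a b c : V} (hab : Forced G K a b) (hbc : G.Adj b c)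
    (hFbc : ¬ Forced G K b c) (hFcb : ¬ Forced G K c b) : G.Adj a c := by
  have hne : a ≠ c := by
    rintro rfl
    exact hFcb hab
  exact not_not.1 fun hac => hFbc (hab.moral hbc hne hac)

theorem Forced.of_not_forced {a b c : V} (hab : Forced G K a b) (hc : c ∉ K) (hbc : G.Adj b c)
    (hFbc : ¬ Forced G K b c) (hFcb : ¬ Forced G K c b) : Forced G K a c := by
  induction hab generalizing c with
  | base ha hb hab => exact .base ha hc ((base ha hb hab).adj_of_not_forced hbc hFbc hFcb)
  | @moral d a b hda hab hne hdb ih =>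
    have hFab : Forced G K a b := hda.moral hab hne hdb
    have hac := hFab.adj_of_not_forced hbc hFbc hFcb
    by_contra hFac
    have hdc : Forced G K d c := ih hc hac hFac fun hFca => hFcb (hFca.trans hFab hbc.symm)
    exact hFcb (hdc.moral hbc.symm hne hdb)
  | trans had hdb hab _ ih =>
    exact had.trans (ih hc hbc hFbc hFcb) ((had.trans hdb hab).adj_of_not_forced hbc hFbc hFcb)

/-- The graph of the edges outside of `K` that are not forced. It has the same vertices as `G`,
those of `K` being isolated. -/
def freeGraph (G : SimpleGraph V) (K : Finset V) : SimpleGraph V where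
  Adj u v := G.Adj u v ∧ (u ∉ K ∧ v ∉ K) ∧ ¬ Forced G K u v ∧ ¬ Forced G K v u
  symm := ⟨fun _ _ h => ⟨h.1.symm, h.2.1.symm, h.2.2.symm⟩⟩
  loopless := ⟨fun _ h => h.1.ne rfl⟩

theorem freeGraph_le : freeGraph G K ≤ G :=
  fun _ _ h => h.1

theorem Ancestral.forced_of_sdiff_adj (hK : Ancestral D (K : Set V)) (hD : IsAMO G D) {u v : V}
    (huv : (D \ arcs (freeGraph G K)).Adj u v) (hv : v ∉ K) : Forced G K u v := by
  by_cases hu : u ∈ K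
  · exact .base hu hv (hD.adj huv.1)
  · by_contra hFuv
    exact huv.2 ⟨hD.adj huv.1, ⟨hu, hv⟩, hFuv,
      fun hFvu => hD.oriented u v huv.1 (hFvu.adj_of_ancestral hD hK)⟩

theorem Ancestral.isDetached_freeGraph (hK : Ancestral D (K : Set V)) (hD : IsAMO G D) :
    IsDetached (freeGraph G K) D := by
  intro a b c hab hbc
  have hFab := hK.forced_of_sdiff_adj hD hab hbc.2.1.1
  have hFac := hFab.of_not_forced hbc.2.1.2 hbc.1 hbc.2.2.1 hbc.2.2.2
  exact ⟨hFac.adj_of_ancestral hD hK, fun h => h.2.2.1 hFac⟩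

end ForcedEdges

section InitialPermsAndForcedEdges

variable {V : Type*} [DecidableEq V] {G : SimpleGraph V} {K : Finset V} {D E : Digraph V}
  {π : List V}

theorem IsInitialPerm.adj_of_mem (hD : IsInitialPerm D K π) (hE : IsInitialPerm E K π)
    (horiented : ∀ u v, D.Adj u v → ¬ D.Adj v u) {u v : V} (hu : u ∈ K) (hv : v ∈ K)
    (huv : D.Adj u v) : E.Adj u v := by
  have hmem {w : V} (hw : w ∈ K) : w ∈ π := by
    rwa [← hD.mem_permsOf.2, List.mem_toFinset] at hw
  have hne : u ≠ v := fun h => horiented v v (h ▸ huv) (h ▸ huv)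
  let Agree (u v : V) : Prop := (D.Adj u v ∧ E.Adj u v) ∨ (D.Adj v u ∧ E.Adj v u)
  have : Std.Symm Agree := ⟨fun _ _ => Or.symm⟩
  have hagree : Agree u v :=
    ((hD.pairwise.and hE.pairwise).imp (S := Agree) .inl).forall (hmem hu) (hmem hv) hne
  exact (hagree.resolve_right fun h => horiented u v huv h.1).2

theorem IsInitialPerm.sdiff_arcs_freeGraph_le (hDπ : IsInitialPerm D K π)
    (hEπ : IsInitialPerm E K π) (hD : IsAMO G D) (hE : IsAMO G E) :
    D \ arcs (freeGraph G K) ≤ E \ arcs (freeGraph G K) := by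
  intro u v huv
  refine ⟨?_, huv.2⟩
  by_cases hv : v ∈ K
  · exact hDπ.adj_of_mem hEπ hD.oriented (hDπ.ancestral huv.1 hv) hv huv.1
  · exact (hDπ.ancestral.forced_of_sdiff_adj hD huv hv).adj_of_ancestral hE hEπ.ancestral

theorem IsInitialPerm.of_sdiff_arcs_freeGraph_eq (hEπ : IsInitialPerm E K π)
    (h : D \ arcs (freeGraph G K) = E \ arcs (freeGraph G K)) : IsInitialPerm D K π := by
  have hadj {u v : V} (hv : v ∈ K) : D.Adj u v ↔ E.Adj u v := by
    have hfree : ¬ (freeGraph G K).Adj u v := fun h => h.2.1.2 hv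
    have := congrFun₂ (congrArg Digraph.Adj h) u v
    simpa [arcs, hfree] using this
  refine ⟨hEπ.mem_permsOf, fun u v huv hv => hEπ.ancestral ((hadj hv).1 huv) hv,
    hEπ.pairwise.imp_of_mem fun _ hv => (hadj ?_).2⟩
  rw [← hEπ.mem_permsOf.2]
  exact List.mem_toFinset.2 hv

theorem IsInitialPerm.ncard_setOf_isInitialPerm [Finite V] {α : Type*} [LinearOrder α]
    {f : V → α} (hf : IsPerfectNumbering G f) (hEπ : IsInitialPerm E K π) (hE : IsAMO G E) :
    {D | IsAMO G D ∧ IsInitialPerm D K π}.ncard = numAMO (freeGraph G K) := by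
  rw [← (hEπ.ancestral.isDetached_freeGraph hE).ncard_setOf_sdiff_arcs_eq hf freeGraph_le hE]
  congr 1
  ext D
  refine and_congr_right fun hD => ⟨fun hDπ => ?_, hEπ.of_sdiff_arcs_freeGraph_eq⟩
  exact le_antisymm (hDπ.sdiff_arcs_freeGraph_le hEπ hD hE)
    (hEπ.sdiff_arcs_freeGraph_le hDπ hE hD)

theorem cliqueOrientation_adj_iff [Finite V] (hK : G.IsClique (K : Set V)) (u v : V) :
    (cliqueOrientation G K).Adj u v ↔
      ∃ D, IsAMO G D ∧ Ancestral D (K : Set V) ∧ D.Adj u v := by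
  simp only [cliqueOrientation, permOrientation, Digraph.iSup_adj, Digraph.sSup_adj]
  constructor
  · rintro ⟨π, hπ, D, ⟨hD, τ, hτ, hπτ⟩, huv⟩
    exact ⟨D, hD, (hτ.isInitialPerm hD hK hπ hπτ).ancestral, huv⟩
  · rintro ⟨D, hD, hKD, huv⟩
    obtain ⟨π, hπ, -⟩ := existsUnique_isInitialPerm hD hK hKD
    exact ⟨π, hπ.mem_permsOf, D, ⟨hD, hπ.exists_isTopologicalOrdering hD⟩, huv⟩

end InitialPermsAndForcedEdges

namespace RootedCliqueTree

variable {V W : Type*} [Finite V] {G : SimpleGraph V} (𝒯 : RootedCliqueTree G W)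

theorem exists_isAMO_ancestral_adj (x : W) {u v : V} (h : (freeGraph G (𝒯.ι x)).Adj u v) :
    ∃ D, IsAMO G D ∧ Ancestral D (𝒯.ι x : Set V) ∧ D.Adj u v := by
  classical
  obtain ⟨E, hE, hEπ⟩ :=
    𝒯.exists_isInitialPerm x ⟨(𝒯.ι x).nodup_toList, (𝒯.ι x).toList_toFinset⟩
  obtain ⟨D, hD, huv⟩ := 𝒯.exists_isAMO_adj h.1
  obtain ⟨f, hf⟩ := 𝒯.exists_isPerfectNumbering
  have hdetached := hEπ.ancestral.isDetached_freeGraph hE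
  have hδ := hdetached.isAMO_inf freeGraph_le hE hD
  exact ⟨_, hdetached.isAMO_sdiff_arcs_sup hf freeGraph_le hE hδ,
    (hEπ.of_sdiff_arcs_freeGraph_eq (sdiff_arcs_sup_sdiff_arcs hδ)).ancestral, .inr ⟨huv, h⟩⟩

theorem undirectedPart_adj_iff [DecidableEq V] (x : W) (u v : {v // v ∉ 𝒯.ι x}) :
    (undirectedPart G (𝒯.ι x)).Adj u v ↔ (freeGraph G (𝒯.ι x)).Adj u v := by
  constructor
  · rintro ⟨-, huv, hvu⟩
    rw [cliqueOrientation_adj_iff (𝒯.isClique x)] at huv hvu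
    obtain ⟨D, hD, hKD, huv⟩ := huv
    obtain ⟨D', hD', hKD', hvu⟩ := hvu
    exact ⟨hD.adj huv, ⟨u.2, v.2⟩, fun h => hD'.oriented _ _ hvu (h.adj_of_ancestral hD' hKD'),
      fun h => hD.oriented _ _ huv (h.adj_of_ancestral hD hKD)⟩
  · intro h
    have hadj {a b : V} (hab : (freeGraph G (𝒯.ι x)).Adj a b) :
        (cliqueOrientation G (𝒯.ι x)).Adj a b :=
      (cliqueOrientation_adj_iff (𝒯.isClique x) a b).2 (𝒯.exists_isAMO_ancestral_adj x hab)
    exact ⟨h.ne, hadj h, hadj h.symm⟩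

end RootedCliqueTree

section Products

variable {V ι : Type*} {X : ι → Type*} {U : SimpleGraph V} {D : Digraph V}
  {f : (Σ i, X i) → V} {δ : ∀ i, Digraph (X i)}

/-- The pullback of a digraph along a map of vertices, for example the restriction to a set. -/
def pullback {Y : Type*} (D : Digraph V) (e : Y → V) : Digraph Y where
  Adj x y := D.Adj (e x) (e y)

/-- The digraph on `V` whose edges are those of the digraphs `δ i`, transported along `f`. -/
def assemble (f : (Σ i, X i) → V) (δ : ∀ i, Digraph (X i)) : Digraph V where
  Adj u v := ∃ i x y, f ⟨i, x⟩ = u ∧ f ⟨i, y⟩ = v ∧ (δ i).Adj x y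

theorem IsAMO.pullback {Y : Type*} {e : Y → V} (hD : IsAMO U D) (he : e.Injective) :
    IsAMO (U.comap e) (pullback D e) where
  skeleton x y := hD.skeleton (e x) (e y)
  oriented x y := hD.oriented (e x) (e y)
  acyclic x h := hD.acyclic (e x) (h.lift e fun _ _ => id)
  moral _ _ _ hne := hD.moral _ _ _ (he.ne hne)

theorem assemble_adj_iff (hf : f.Injective) {i : ι} {x y : X i} :
    (assemble f δ).Adj (f ⟨i, x⟩) (f ⟨i, y⟩) ↔ (δ i).Adj x y := by
  refine ⟨?_, fun h => ⟨i, x, y, rfl, rfl, h⟩⟩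
  rintro ⟨j, x', y', hx, hy, h⟩
  cases hf hx
  cases hf hy
  exact h

theorem exists_transGen_of_transGen_assemble (hf : f.Injective) {u v : V}
    (h : TransGen (assemble f δ).Adj u v) :
    ∃ i x y, f ⟨i, x⟩ = u ∧ f ⟨i, y⟩ = v ∧ TransGen (δ i).Adj x y := by
  induction h with
  | single h =>
    obtain ⟨i, x, y, hx, hy, h⟩ := h
    exact ⟨i, x, y, hx, hy, .single h⟩
  | tail _ h ih =>
    obtain ⟨i, x, y, hx, hy, hxy⟩ := ih
    obtain ⟨j, y', z, hy', hz, hyz⟩ := h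
    cases hf (hy.trans hy'.symm)
    exact ⟨i, x, z, hx, hz, hxy.tail hyz⟩

theorem isAMO_assemble (hf : f.Injective)
    (hU : ∀ u v, U.Adj u v → ∃ i x y, f ⟨i, x⟩ = u ∧ f ⟨i, y⟩ = v)
    (hδ : ∀ i, IsAMO (U.comap fun x => f ⟨i, x⟩) (δ i)) : IsAMO U (assemble f δ) where
  skeleton u v := by
    constructor
    · intro h
      obtain ⟨i, x, y, rfl, rfl⟩ := hU u v h
      rw [assemble_adj_iff hf, assemble_adj_iff hf]
      exact ((hδ i).skeleton x y).1 h
    · rintro (⟨i, x, y, rfl, rfl, h⟩ | ⟨i, x, y, rfl, rfl, h⟩)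
      · exact (hδ i).adj h
      · exact ((hδ i).adj h).symm
  oriented := by
    rintro _ _ ⟨i, x, y, rfl, rfl, h⟩ h'
    exact (hδ i).oriented x y h ((assemble_adj_iff hf).1 h')
  acyclic v h := by
    obtain ⟨i, x, y, hx, hy, hxy⟩ := exists_transGen_of_transGen_assemble hf h
    cases hf (hx.trans hy.symm)
    exact (hδ i).acyclic x hxy
  moral := by
    rintro _ _ _ hne ⟨i, a, b, rfl, rfl, hab⟩ ⟨j, c, b', rfl, hb, hcb⟩
    cases hf hb
    exact (hδ i).moral a b c (fun hac => hne (hac ▸ rfl)) hab hcb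

theorem numAMO_eq_prod_comap [Fintype ι] (hf : f.Injective)
    (hU : ∀ u v, U.Adj u v → ∃ i x y, f ⟨i, x⟩ = u ∧ f ⟨i, y⟩ = v) :
    numAMO U = ∏ i, numAMO (U.comap fun x => f ⟨i, x⟩) := by
  let restrictEquiv : {D // IsAMO U D} ≃ ∀ i, {δ // IsAMO (U.comap fun x => f ⟨i, x⟩) δ} :=
    { toFun := fun D i => ⟨pullback D.1 _, D.2.pullback (hf.comp sigma_mk_injective)⟩
      invFun := fun δ => ⟨assemble f fun i => (δ i).1, isAMO_assemble hf hU fun i => (δ i).2⟩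
      left_inv := by
        rintro ⟨D, hD⟩
        refine Subtype.ext (Digraph.ext (funext₂ fun u v => propext ⟨?_, fun h => ?_⟩))
        · rintro ⟨i, x, y, rfl, rfl, h⟩
          exact h
        · obtain ⟨i, x, y, rfl, rfl⟩ := hU u v (hD.adj h)
          exact ⟨i, x, y, rfl, rfl, h⟩
      right_inv := fun δ => funext fun i =>
        Subtype.ext (Digraph.ext (funext₂ fun x y => propext (assemble_adj_iff hf))) }
  exact (Nat.card_congr restrictEquiv).trans Nat.card_pi

theorem numAMO_eq_prod_connectedComponent {Y : Type*} {U' : SimpleGraph Y}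
    [Fintype U'.ConnectedComponent] (e : U' ↪g U) (hU : U.support ⊆ Set.range e) :
    numAMO U = ∏ H : U'.ConnectedComponent, numAMO H.toSimpleGraph := by
  have hprod := numAMO_eq_prod_comap (U := U) (X := fun H : U'.ConnectedComponent => H)
    (f := fun x => e x.2) ?_ fun u v huv => ?_
  · exact hprod.trans (Finset.prod_congr rfl fun H _ =>
      congrArg numAMO (SimpleGraph.ext (funext₂ fun x y => propext e.map_adj_iff)))
  · rintro ⟨H, x, hx⟩ ⟨H', y, hy⟩ hxy
    obtain rfl : x = y := e.injective hxy
    obtain rfl : H = H' := hx.symm.trans hy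
    rfl
  · obtain ⟨x, rfl⟩ := hU ⟨v, huv⟩
    obtain ⟨y, rfl⟩ := hU ⟨e x, huv.symm⟩
    exact ⟨_, ⟨x, rfl⟩, ⟨y, SimpleGraph.ConnectedComponent.connectedComponentMk_eq_of_adj
      (e.map_adj_iff.1 huv.symm)⟩, rfl, rfl⟩

end Products

section Counting

theorem ncard_eq_sum_ncard_of_existsUnique {α ι : Type*} [Finite α] [Fintype ι] {s : Set α}
    {r : α → ι → Prop} (h : ∀ a ∈ s, ∃! i, r a i) : s.ncard = ∑ i, {a ∈ s | r a i}.ncard := by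
  have hs : s = ⋃ i, {a ∈ s | r a i} := by
    ext a
    simp only [Set.mem_iUnion, Set.mem_ofPred_eq, exists_and_left]
    exact ⟨fun ha => ⟨ha, (h a ha).exists⟩, And.left⟩
  conv_lhs => rw [hs]
  rw [Set.ncard_iUnion_of_finite (fun _ => Set.toFinite _), finsum_eq_sum_of_fintype]
  exact fun i j hij => Set.disjoint_left.2 fun a hi hj => hij ((h a hi.1).unique hi.2 hj.2)

instance instFiniteDigraph {V : Type*} [Finite V] : Finite (Digraph V) :=
  Finite.of_injective Digraph.Adj fun _ _ => Digraph.ext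

variable {V : Type*} [Finite V] [DecidableEq V] {G : SimpleGraph V} {K : Finset V}
  {R : Set (Finset V)}

theorem ncard_setOf_ancestral_eq_phi_mul {α : Type*} [LinearOrder α] {f : V → α}
    (hf : IsPerfectNumbering G f) (hK : G.IsClique (K : Set V)) (hR : ∀ S ∈ R, S ⊆ K)
    (hexists : ∀ π ∈ permsOf K, ∃ D, IsAMO G D ∧ IsInitialPerm D K π) :
    {D | IsAMO G D ∧ Ancestral D (K : Set V) ∧ ∀ S ∈ R, ¬ Ancestral D (S : Set V)}.ncard =
      phi K R * numAMO (freeGraph G K) := by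
  let P : Set (List V) := {π ∈ permsOf K | ∀ p : List V, p <+: π → p.toFinset ∉ R}
  have : Fintype P := ((finite_permsOf K).subset fun _ h => h.1).fintype
  have hmem_P {D : Digraph V} {π : List V} (hD : IsAMO G D) (hπ : IsInitialPerm D K π) :
      π ∈ P ↔ ∀ S ∈ R, ¬ Ancestral D (S : Set V) := by
    refine (and_iff_right hπ.mem_permsOf).trans ⟨fun h S hS hanc => ?_, fun h p hp hS => ?_⟩
    · obtain ⟨p, hp, rfl⟩ := (hπ.exists_prefix_iff hD.oriented (hR S hS)).2 hanc
      exact h p hp hS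
    · exact h _ hS ((hπ.exists_prefix_iff hD.oriented (hR _ hS)).1 ⟨p, hp, rfl⟩)
  rw [ncard_eq_sum_ncard_of_existsUnique (r := fun D (π : P) => IsInitialPerm D K π)]
  · have hfiber (π : P) : {D ∈ {D | IsAMO G D ∧ Ancestral D (K : Set V) ∧
        ∀ S ∈ R, ¬ Ancestral D (S : Set V)} | IsInitialPerm D K π}.ncard =
          numAMO (freeGraph G K) := by
      obtain ⟨E, hE, hEπ⟩ := hexists π π.2.1
      rw [← hEπ.ncard_setOf_isInitialPerm hf hE]
      congr 1
      ext D
      exact ⟨fun h => ⟨h.1.1, h.2⟩, fun h => ⟨⟨h.1, h.2.ancestral, (hmem_P h.1 h.2).1 π.2⟩, h.2⟩⟩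
    rw [Finset.sum_congr rfl fun π _ => hfiber π, Finset.sum_const, smul_eq_mul,
      Finset.card_univ, ← Nat.card_eq_fintype_card]
    rfl
  · rintro D ⟨hD, hKD, hRD⟩
    obtain ⟨π, hπ, hunique⟩ := existsUnique_isInitialPerm hD hK hKD
    exact ⟨⟨π, (hmem_P hD hπ).2 hRD⟩, hπ, fun ρ hρ => Subtype.ext (hunique ρ hρ)⟩

end Counting

namespace RootedCliqueTree

variable {V W : Type*} [DecidableEq V] {G : SimpleGraph V}
  (𝒯 : RootedCliqueTree G W)

theorem numAMO_eq_sum_phi_mul_numAMO_freeGraph [Finite V] [Fintype W] :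
    numAMO G = ∑ x : W, phi (𝒯.ι x) (𝒯.FP x) * numAMO (freeGraph G (𝒯.ι x)) := by
  obtain ⟨f, hf⟩ := 𝒯.exists_isPerfectNumbering
  refine (ncard_eq_sum_ncard_of_existsUnique fun D hD => 𝒯.existsUnique_ancestral_node hD).trans
    (Finset.sum_congr rfl fun x _ => ?_)
  refine ncard_setOf_ancestral_eq_phi_mul hf (𝒯.isClique x) ?_ fun π => 𝒯.exists_isInitialPerm x
  rintro S ⟨-, -, -, -, -, hS⟩
  exact hS

theorem numAMO_freeGraph_eq_prod [Fintype V] (x : W) :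
    numAMO (freeGraph G (𝒯.ι x)) = ∏ H : Components G (𝒯.ι x), numAMO H.toSimpleGraph :=
  numAMO_eq_prod_connectedComponent
    ⟨Function.Embedding.subtype _, (𝒯.undirectedPart_adj_iff x _ _).symm⟩
    fun u ⟨_, huv⟩ => ⟨⟨u, huv.2.1.1⟩, rfl⟩

end RootedCliqueTree

end CliquePicking

theorem mainTheorem3_general {V W : Type*} [Fintype V] [DecidableEq V] [Fintype W]
    (G : SimpleGraph V) (𝒯 : CliquePicking.RootedCliqueTree G W) :
    CliquePicking.numAMO G =
      ∑ v : W, CliquePicking.phi (𝒯.ι v) (𝒯.FP v) *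
        ∏ H : CliquePicking.Components G (𝒯.ι v),
          CliquePicking.numAMO H.toSimpleGraph := by
  rw [𝒯.numAMO_eq_sum_phi_mul_numAMO_freeGraph]
  exact Finset.sum_congr rfl fun v _ => by rw [𝒯.numAMO_freeGraph_eq_prod]

theorem mainTheorem3 {V W : Type*} [Fintype V] [DecidableEq V] [Fintype W]
    (G : SimpleGraph V) (hG : CliquePicking.IsUCCG G)
    (𝒯 : CliquePicking.RootedCliqueTree G W) :
    CliquePicking.numAMO G =
      ∑ v : W, CliquePicking.phi (𝒯.ι v) (𝒯.FP v) *
        ∏ H : CliquePicking.Components G (𝒯.ι v),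
          CliquePicking.numAMO H.toSimpleGraph :=
  mainTheorem3_general G 𝒯
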